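/- Let $p\in(0,1)$, $q:=1-p$, and let $(q_n)_{n\ge1}\subset[0,1]$ satisfy $\sum_{n\ge1}q_n=1$. Let $P$ be the Markov kernel on $\mathbb N=\{0,1,2,\dots\}$ given by $P(0,n)=q_n$, $P(n,0)=p$, $P(n,n+1)=q$ for all $n\ge1$, all other entries being $0$. Let $\gamma\in(1,1/q)$ be such that $\sum_{n\ge1}q_n\gamma^n<\infty$, put $V_\gamma(n):=\gamma^n$, and let $\mathcal B_\gamma$ be the space of all $f:\mathbb N\to\mathbb C$ with $\|f\|:=\sup_{n}\gamma^{-n}|f(n)|<\infty$. Then: (i) $P$ acts on $\mathcal B_\gamma$ as a bounded operator by $(Pf)(n)=\sum_jP(n,j)f(j)$, this operator is quasi-compact, and its essential spectral radius satisfies $r_{ess}(P)\le q\gamma$. (ii) $P$ is $V_\gamma$-geometrically ergodic, that is, $P$ has an invariant probability measure $\pi$ with $\pi(V_\gamma)<\infty$ and there are $\rho\in(0,1)$ and $c>0$ with $\sup_{\|f\|\le1}\|P^nf-\pi(f)1\|\le c\,\rho^n$ for all $n$; moreover the convergence rate $\rho_{V_\gamma}(P):=\inf\{\rho\in(0,1):\sup_{\|f\|\le1}\|P^nf-\pi(f)1\|=O(\rho^n)\}$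 satisfies $\rho_{V_\gamma}(P)\le\max(q\gamma,p)$. Here $P$ is called quasi-compact if for some $r_0\in(0,1)$ the following holds: there are $m\ge1$, $\lambda_i\in\mathbb C$ and $p_i\ge1$ ($i=1,\dots,m$) such that $\mathcal B_\gamma=\bigoplus_{i=1}^m\ker(P-\lambda_iI)^{p_i}\oplus H$, where $|\lambda_i|\ge r_0$, $1\le\dim\ker(P-\lambda_iI)^{p_i}<\infty$, and $H$ is a closed $P$-invariant subspace with $\inf_{n\ge1}\big(\sup_{h\in H,\|h\|\le1}\|P^nh\|\big)^{1/n}<r_0$; and $r_{ess}(P)$ is the infimum of all such $r_0\in(0,1)$. -/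

import Mathlib

open Set

noncomputable section

/-- A Markov kernel on the discrete state space `ℕ`, given as a stochastic matrix. -/
structure MarkovMatrix where
  /-- the transition probabilities -/
  prob : ℕ → ℕ → ℝ
  nonneg : ∀ i j, 0 ≤ prob i j
  hasSum_one : ∀ i, HasSum (fun j => prob i j) 1

/-- A weight function `V : ℕ → [1, +∞)`. -/
structure Weight where
  /-- the values of the weight -/
  val : ℕ → ℝ
  one_le : ∀ n, 1 ≤ val n

theorem Weight.pos (V : Weight) (n : ℕ) : 0 < V.val n :=
  lt_of_lt_of_le one_pos (V.one_le n)

/-- The geometric weight `V_γ(n) = γ ^ n`. -/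
def geomWeight (γ : ℝ) (hγ : 1 < γ) : Weight where
  val n := γ ^ n
  one_le _ := one_le_pow₀ hγ.le

/-! ### The weighted-supremum space -/

/-- The functions `f : ℕ → ℂ` with `sup_n |f n| / V n < ∞`, as a linear subspace. -/
def weightedSubmodule (V : Weight) : Submodule ℂ (ℕ → ℂ) where
  carrier := {f | BddAbove (range fun n => ‖f n‖ / V.val n)}
  zero_mem' := ⟨0, by rintro _ ⟨n, rfl⟩; simp⟩
  add_mem' := by
    rintro f g ⟨a, ha⟩ ⟨b, hb⟩
    refine ⟨a + b, ?_⟩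
    rintro _ ⟨n, rfl⟩
    have h1 : ‖f n‖ / V.val n ≤ a := ha ⟨n, rfl⟩
    have h2 : ‖g n‖ / V.val n ≤ b := hb ⟨n, rfl⟩
    calc ‖(f + g) n‖ / V.val n ≤ (‖f n‖ + ‖g n‖) / V.val n :=
          div_le_div_of_nonneg_right (norm_add_le _ _) (V.pos n).le
      _ = ‖f n‖ / V.val n + ‖g n‖ / V.val n := add_div _ _ _
      _ ≤ a + b := add_le_add h1 h2
  smul_mem' := by
    rintro c f ⟨a, ha⟩
    refine ⟨‖c‖ * a, ?_⟩
    rintro _ ⟨n, rfl⟩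
    have h1 : ‖f n‖ / V.val n ≤ a := ha ⟨n, rfl⟩
    calc ‖(c • f) n‖ / V.val n = ‖c‖ * (‖f n‖ / V.val n) := by
          simp [mul_div_assoc]
      _ ≤ ‖c‖ * a := mul_le_mul_of_nonneg_left h1 (norm_nonneg c)

/-- The weighted-supremum space `B_V`.  It is a type of its own, so that its topology is the one of
the norm below and not the one of pointwise convergence. -/
def WeightedSpace (V : Weight) : Type := weightedSubmodule V

namespace WeightedSpace

variable {V : Weight}

instance : AddCommGroup (WeightedSpace V) := inferInstanceAs (AddCommGroup (weightedSubmodule V))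
instance : Module ℂ (WeightedSpace V) := inferInstanceAs (Module ℂ (weightedSubmodule V))

/-- The function underlying an element of `B_V`. -/
def toFun (f : WeightedSpace V) : ℕ → ℂ := Subtype.val f

instance : CoeFun (WeightedSpace V) (fun _ => ℕ → ℂ) := ⟨toFun⟩

/-- An element of `B_V` from a function. -/
def mk (f : ℕ → ℂ) (hf : BddAbove (range fun n => ‖f n‖ / V.val n)) : WeightedSpace V := ⟨f, hf⟩

theorem ext' {f g : WeightedSpace V} (h : ∀ n, f n = g n) : f = g := Subtype.ext (funext h)

@[simp] theorem mk_apply (f : ℕ → ℂ) (hf : BddAbove (range fun n => ‖f n‖ / V.val n)) (n : ℕ) :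
    (mk f hf : WeightedSpace V) n = f n := rfl
@[simp] theorem zero_apply (n : ℕ) : (0 : WeightedSpace V) n = 0 := rfl
@[simp] theorem add_apply (f g : WeightedSpace V) (n : ℕ) : (f + g) n = f n + g n := rfl
@[simp] theorem neg_apply (f : WeightedSpace V) (n : ℕ) : (-f) n = -f n := rfl
@[simp] theorem smul_apply (c : ℂ) (f : WeightedSpace V) (n : ℕ) : (c • f) n = c * f n := rfl

theorem bddAbove (f : WeightedSpace V) : BddAbove (range fun n => ‖f n‖ / V.val n) := f.2

/-- `‖f‖_V = sup_n |f n| / V n`. -/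
instance : Norm (WeightedSpace V) := ⟨fun f => ⨆ n, ‖f n‖ / V.val n⟩

theorem norm_def (f : WeightedSpace V) : ‖f‖ = ⨆ n, ‖f n‖ / V.val n := rfl

theorem div_le_norm (f : WeightedSpace V) (n : ℕ) : ‖f n‖ / V.val n ≤ ‖f‖ :=
  le_ciSup f.bddAbove n

theorem apply_le_norm (f : WeightedSpace V) (n : ℕ) : ‖f n‖ ≤ ‖f‖ * V.val n :=
  (div_le_iff₀ (V.pos n)).1 (f.div_le_norm n)

theorem norm_le_of (f : WeightedSpace V) {C : ℝ} (h : ∀ n, ‖f n‖ ≤ C * V.val n) : ‖f‖ ≤ C :=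
  ciSup_le fun n => (div_le_iff₀ (V.pos n)).2 (h n)

instance : NormedAddCommGroup (WeightedSpace V) :=
  AddGroupNorm.toNormedAddCommGroup
    { toFun := fun f => ‖f‖
      map_zero' := by simp [norm_def]
      add_le' := fun f g => norm_le_of _ fun n => by
        rw [add_mul, add_apply]
        exact (norm_add_le _ _).trans (add_le_add (f.apply_le_norm n) (g.apply_le_norm n))
      neg' := fun f => by simp [norm_def]
      eq_zero_of_map_eq_zero' := fun f hf => ext' fun n => by
        have h := f.apply_le_norm n
        rw [hf, zero_mul] at h
        simpa using h }

instance : NormedSpace ℂ (WeightedSpace V) where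
  norm_smul_le c f := norm_le_of _ fun n => by
    rw [smul_apply, norm_mul, mul_assoc]
    exact mul_le_mul_of_nonneg_left (f.apply_le_norm n) (norm_nonneg c)

variable (V) in
/-- The constant function `1` as an element of `B_V`. -/
def one : WeightedSpace V := mk (fun _ => 1) ⟨1, by
  rintro _ ⟨n, rfl⟩
  simpa using inv_le_one_of_one_le₀ (V.one_le n)⟩

end WeightedSpace

/-! ### The action of a Markov kernel on `B_V` -/

namespace MarkovMatrix

/-- `P V` is finite and `sup_n (P V)(n) / V(n) < ∞`, so that `P` acts boundedly on `B_V`. -/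
def ActsOn (P : MarkovMatrix) (V : Weight) : Prop :=
  (∀ n, Summable fun j => P.prob n j * V.val j) ∧
    BddAbove (range fun n => (∑' j, P.prob n j * V.val j) / V.val n)

variable {P : MarkovMatrix} {V : Weight}

theorem ActsOn.norm_term_le (f : WeightedSpace V) (n j : ℕ) :
    ‖(P.prob n j : ℂ) * f j‖ ≤ ‖f‖ * (P.prob n j * V.val j) := by
  rw [norm_mul, Complex.norm_real, Real.norm_of_nonneg (P.nonneg n j), mul_left_comm]
  exact mul_le_mul_of_nonneg_left (f.apply_le_norm j) (P.nonneg n j)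

theorem ActsOn.summable (h : P.ActsOn V) (f : WeightedSpace V) (n : ℕ) :
    Summable fun j => (P.prob n j : ℂ) * f j :=
  Summable.of_norm_bounded ((h.1 n).mul_left ‖f‖) (norm_term_le f n)

theorem ActsOn.norm_tsum_le (h : P.ActsOn V) (f : WeightedSpace V) (n : ℕ) :
    ‖∑' j, (P.prob n j : ℂ) * f j‖ ≤
      (⨆ n, (∑' j, P.prob n j * V.val j) / V.val n) * ‖f‖ * V.val n := by
  have h1 : ‖∑' j, (P.prob n j : ℂ) * f j‖ ≤ ‖f‖ * ∑' j, P.prob n j * V.val j :=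
    tsum_of_norm_bounded ((h.1 n).hasSum.mul_left ‖f‖) (norm_term_le f n)
  have h2 := (div_le_iff₀ (V.pos n)).1 (le_ciSup h.2 n)
  calc _ ≤ _ := h1
    _ ≤ _ := mul_le_mul_of_nonneg_left h2 (norm_nonneg f)
    _ = _ := by ring

/-- The bounded operator `(P f)(n) = ∑_j P(n, j) f(j)` on `B_V`. -/
def op (P : MarkovMatrix) (V : Weight) (h : P.ActsOn V) :
    WeightedSpace V →L[ℂ] WeightedSpace V :=
  LinearMap.mkContinuous
    { toFun := fun f => WeightedSpace.mk (fun n => ∑' j, (P.prob n j : ℂ) * f j)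
        ⟨(⨆ n, (∑' j, P.prob n j * V.val j) / V.val n) * ‖f‖, by
          rintro _ ⟨n, rfl⟩
          exact (div_le_iff₀ (V.pos n)).2 (h.norm_tsum_le f n)⟩
      map_add' := fun f g => WeightedSpace.ext' fun n => by
        simp only [WeightedSpace.mk_apply, WeightedSpace.add_apply, mul_add]
        exact (h.summable f n).tsum_add (h.summable g n)
      map_smul' := fun c f => WeightedSpace.ext' fun n => by
        simp only [WeightedSpace.mk_apply, WeightedSpace.smul_apply, RingHom.id_apply,
          mul_left_comm _ c]
        exact tsum_mul_left }
    (⨆ n, (∑' j, P.prob n j * V.val j) / V.val n)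
    (fun f => WeightedSpace.norm_le_of _ fun n => h.norm_tsum_le f n)

theorem op_apply (h : P.ActsOn V) (f : WeightedSpace V) (n : ℕ) :
    P.op V h f n = ∑' j, (P.prob n j : ℂ) * f j := rfl

/-! ### `V`-geometric ergodicity -/

/-- `π` is an invariant probability measure of `P` with `π(V) < ∞`. -/
structure IsInvariantProb (P : MarkovMatrix) (V : Weight) (π : ℕ → ℝ) : Prop where
  nonneg : ∀ i, 0 ≤ π i
  hasSum_one : HasSum π 1
  invariant : ∀ j, HasSum (fun i => π i * P.prob i j) (π j)
  summable_weight : Summable fun i => π i * V.val i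

/-- `sup_{‖f‖_V ≤ 1} ‖P^n f - π(f) 1‖_V ≤ c ρ^n` for all `n`, with a constant `c`. -/
def ConvergesAtRate (P : MarkovMatrix) (V : Weight) (h : P.ActsOn V) (π : ℕ → ℝ) (ρ : ℝ) : Prop :=
  ∃ c : ℝ, ∀ (n : ℕ) (f : WeightedSpace V), ‖f‖ ≤ 1 →
    ‖(P.op V h ^ n) f - (∑' i, (π i : ℂ) * f i) • WeightedSpace.one V‖ ≤ c * ρ ^ n

/-- `V`-geometric ergodicity, with invariant probability measure `π`. -/
def IsGeomErgodic (P : MarkovMatrix) (V : Weight) (h : P.ActsOn V) (π : ℕ → ℝ) : Prop :=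
  P.IsInvariantProb V π ∧ ∃ ρ ∈ Ioo (0 : ℝ) 1, P.ConvergesAtRate V h π ρ

/-- The convergence rate `ρ_V(P)`. -/
def convRate (P : MarkovMatrix) (V : Weight) (h : P.ActsOn V) (π : ℕ → ℝ) : ℝ :=
  sInf {ρ | ρ ∈ Ioo (0 : ℝ) 1 ∧ P.ConvergesAtRate V h π ρ}

end MarkovMatrix

/-! ### Quasi-compactness and the essential spectral radius -/

/-- The decomposition `E = ⨁_i ker (T - λ_i)^{k_i} ⊕ H` at level `r₀`: finitely many (at least one)
`λ_i` with `|λ_i| ≥ r₀`, nonzero finite-dimensional kernels, and a closed `T`-invariant subspace `H`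
with `inf_{n ≥ 1} ‖T^n|_H‖^{1/n} < r₀`. -/
def HasQuasiCompactDecomposition {E : Type*} [NormedAddCommGroup E] [NormedSpace ℂ E]
    (T : E →L[ℂ] E) (r₀ : ℝ) : Prop :=
  ∃ (m : ℕ) (lam : Fin m → ℂ) (k : Fin m → ℕ) (N : Fin m → Submodule ℂ E) (H : Submodule ℂ E),
    1 ≤ m ∧
    (∀ i, 1 ≤ k i) ∧
    (∀ i, N i = LinearMap.ker ((T.toLinearMap - lam i • (1 : Module.End ℂ E)) ^ k i)) ∧
    DirectSum.IsInternal (fun o : Option (Fin m) => o.elim H N) ∧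
    (∀ i, r₀ ≤ ‖lam i‖ ∧ FiniteDimensional ℂ (N i) ∧ 1 ≤ Module.finrank ℂ (N i)) ∧
    IsClosed (H : Set E) ∧
    (∀ x ∈ H, T x ∈ H) ∧
    (⨅ n : ℕ+, ‖(T ^ (n : ℕ)).comp H.subtypeL‖ ^ ((1 : ℝ) / (n : ℕ))) < r₀

/-- Quasi-compactness. -/
def IsQuasiCompact {E : Type*} [NormedAddCommGroup E] [NormedSpace ℂ E] (T : E →L[ℂ] E) : Prop :=
  ∃ r₀ ∈ Ioo (0 : ℝ) 1, HasQuasiCompactDecomposition T r₀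

/-- The essential spectral radius of a quasi-compact operator. -/
def essSpectralRadius {E : Type*} [NormedAddCommGroup E] [NormedSpace ℂ E] (T : E →L[ℂ] E) : ℝ :=
  sInf {r₀ | r₀ ∈ Ioo (0 : ℝ) 1 ∧ HasQuasiCompactDecomposition T r₀}

/-! ### The random walk -/

/-- The matrix with `P(0, n) = a n`, `P(n, 0) = p`, `P(n, n + 1) = 1 - p` for `n ≥ 1`, and all other
entries zero. -/
def walkProb (p : ℝ) (a : ℕ → ℝ) (i j : ℕ) : ℝ :=
  if i = 0 then (if j = 0 then 0 else a j)
  else if j = 0 then p else if j = i + 1 then 1 - p else 0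

/-- The Markov kernel given by `walkProb`; only the values `a n` with `n ≥ 1` matter. -/
def walk (p : ℝ) (hp : p ∈ Ioo (0 : ℝ) 1) (a : ℕ → ℝ) (ha : ∀ n, 1 ≤ n → a n ∈ Icc (0 : ℝ) 1)
    (hsum : HasSum (fun n => a (n + 1)) 1) : MarkovMatrix where
  prob := walkProb p a
  nonneg i j := by
    have h1 := hp.1.le
    have h2 := sub_nonneg.2 hp.2.le
    unfold walkProb
    split_ifs with _ hj
    · exact le_rfl
    · exact (ha j (Nat.one_le_iff_ne_zero.2 hj)).1
    · exact h1
    · exact h2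
    · exact le_rfl
  hasSum_one i := by
    rcases Nat.eq_zero_or_pos i with rfl | hi
    · rw [← hasSum_nat_add_iff' 1]
      simpa [walkProb] using hsum
    · have h := hasSum_sum_of_ne_finset_zero (f := walkProb p a i) (s := {0, i + 1})
        (L := SummationFilter.unconditional ℕ) (by
        intro j hj
        simp only [Finset.mem_insert, Finset.mem_singleton, not_or] at hj
        simp [walkProb, hi.ne', hj.1, hj.2])
      rw [Finset.sum_pair (by omega)] at h
      have e : walkProb p a i 0 + walkProb p a i (i + 1) = 1 := by simp [walkProb, hi.ne']
      rw [e] at h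
      exact h

end

/-! ### Rank-two perturbations of an operator of norm at most `r` on a normed space. -/

section Abstract

variable {E : Type*} [NormedAddCommGroup E] [NormedSpace ℂ E]

/-! Let `S` be the shift `f ↦ q f(· + 1)` set to zero at `0`. Since the weight grows by the factor
`γ` at each step, `‖S‖ ≤ qγ`. The difference `Pf - Sf` is constant on `n ≥ 1`, so it lies in a
plane, and this plane is invariant under `P`: it is spanned by the eigenvectors `u = 1` (eigenvalue
`1`) and `v = (1, -p, -p, …)` (eigenvalue `-p`). Hence `P^n f = S^n f + A_n u + B_n v`
(`walk_op_eq`, `exists_coeff_pow`), and only the scalars need control.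

They are read off from left eigenfunctionals, given by an explicit recursion (`leftEigen`) and
bounded on the space as soon as `qγ < |l|`. For `l = 1` this always holds: the functional is a
multiple of the invariant measure and yields `A_n`. The recursion for `B_n` alone gives growth at
most `ρ^n` for every `ρ > max(qγ, p)`, hence the ergodicity rate. If `qγ < p`, the functional for `l
= -p` is bounded too, and on the common kernel of both functionals `P^n` decays like `(qγ)^n`.

So each level `r` in `(qγ, 1)` admits a decomposition: with the eigenvalue `1` alone if `r > p`,
with `1` and `-p` if `r ≤ p`. -/

theorem exists_pow_mul_rpow_inv_lt {C ρ r : ℝ} (hC : 0 ≤ C) (hρ : 0 ≤ ρ) (hr : ρ < r) :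
    ∃ n : ℕ+, (C * ρ ^ (n : ℕ)) ^ ((1 : ℝ) / (n : ℕ)) < r := by
  have hr0 : 0 < r := hρ.trans_lt hr
  -- After taking `n`-th powers the claim is `C (ρ / r)^n < 1`, true for large `n`.
  have hlim : Filter.Tendsto (fun n : ℕ => C * (ρ / r) ^ n) Filter.atTop (nhds 0) := by
    simpa using (tendsto_pow_atTop_nhds_zero_of_lt_one (div_nonneg hρ hr0.le)
      ((div_lt_one hr0).2 hr)).const_mul C
  obtain ⟨n, hn, hn0⟩ :=
    ((hlim.eventually (gt_mem_nhds one_pos)).and (Filter.eventually_gt_atTop 0)).exists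
  refine ⟨⟨n, hn0⟩, ?_⟩
  have hlt : C * ρ ^ n < r ^ n := by
    rw [div_pow, ← mul_div_assoc, div_lt_one (by positivity)] at hn
    exact hn
  calc (C * ρ ^ n) ^ ((1 : ℝ) / n) < (r ^ n) ^ ((1 : ℝ) / n) :=
        Real.rpow_lt_rpow (by positivity) hlt (by positivity)
    _ = r := by rw [one_div, Real.pow_rpow_inv_natCast hr0.le hn0.ne']

/-- A biorthogonal system of right eigenvectors and left eigenfunctionals, with geometric decay on
the common kernel of the functionals, gives a quasi-compact decomposition. -/
theorem hasQuasiCompactDecomposition_of_biorthogonal {m : ℕ} (hm : 1 ≤ m) (T : E →L[ℂ] E)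
    {r₀ ρ C : ℝ} (hρ : 0 ≤ ρ) (hρr : ρ < r₀) (lam : Fin m → ℂ) (u : Fin m → E)
    (ψ : Fin m → E →L[ℂ] ℂ) (hlam : Function.Injective lam) (hlamr : ∀ i, r₀ ≤ ‖lam i‖)
    (hu : ∀ i, T (u i) = lam i • u i) (hψ : ∀ i x, ψ i (T x) = lam i * ψ i x)
    (hψu : ∀ i j, ψ i (u j) = if i = j then 1 else 0)
    (hdecay : ∀ x, (∀ i, ψ i x = 0) → ∀ n : ℕ, ‖(T ^ n) x‖ ≤ C * ρ ^ n * ‖x‖) :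
    HasQuasiCompactDecomposition T r₀ := by
  have hr0 : 0 < r₀ := hρ.trans_lt hρr
  let H : Submodule ℂ E := ⨅ i, LinearMap.ker (ψ i).toLinearMap
  have memH : ∀ x, x ∈ H ↔ ∀ i, ψ i x = 0 := fun x => by simp [H, Submodule.mem_iInf]
  -- Exponent `1` suffices. If `x` is an eigenvector for `lam i`, then so is `y = x - ψ i x • u i`,
  -- unless it vanishes; every `ψ j` kills `y`, by biorthogonality for `j = i` and because the
  -- eigenvalues differ for `j ≠ i`. Decay at rate `ρ < r₀ ≤ ‖lam i‖` then forces `y = 0`.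
  have hspan : ∀ i, LinearMap.ker ((T.toLinearMap - lam i • (1 : Module.End ℂ E)) ^ 1) =
      Submodule.span ℂ {u i} := by
    intro i
    ext x
    rw [pow_one, LinearMap.mem_ker, Submodule.mem_span_singleton]
    simp only [LinearMap.sub_apply, LinearMap.smul_apply, Module.End.one_apply,
      ContinuousLinearMap.coe_coe, sub_eq_zero]
    constructor
    · intro hx
      refine ⟨ψ i x, ?_⟩
      set y := x - ψ i x • u i with hy
      have hTy : T y = lam i • y := by
        rw [hy, map_sub, map_smul, hu, hx, smul_sub, smul_comm]
      have hψy : ∀ j, ψ j y = 0 := by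
        intro j
        by_cases hj : j = i
        · subst hj
          simp [hy, hψu]
        · have h1 := hψ j y
          rw [hTy, map_smul, smul_eq_mul] at h1
          have h2 : (lam i - lam j) * ψ j y = 0 := by rw [sub_mul, h1, sub_self]
          exact (mul_eq_zero.1 h2).resolve_left (sub_ne_zero.2 fun h => hj (hlam h.symm))
      have hpow : ∀ n : ℕ, (T ^ n) y = lam i ^ n • y := by
        intro n
        induction n with
        | zero => simp
        | succ n ih =>
          rw [pow_succ', mul_apply_eq_comp, ih, map_smul, hTy, smul_smul, pow_succ]
      have hle : ∀ n : ℕ, ‖y‖ ≤ C * (ρ / r₀) ^ n * ‖y‖ := by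
        intro n
        have h1 := hdecay y hψy n
        rw [hpow, norm_smul, norm_pow] at h1
        have h2 : r₀ ^ n * ‖y‖ ≤ C * ρ ^ n * ‖y‖ :=
          (mul_le_mul_of_nonneg_right (pow_le_pow_left₀ hr0.le (hlamr i) n)
            (norm_nonneg _)).trans h1
        have h3 : 0 < r₀ ^ n := by positivity
        rw [div_pow]
        have e : C * (ρ ^ n / r₀ ^ n) * ‖y‖ = (C * ρ ^ n * ‖y‖) / r₀ ^ n := by ring
        rw [e, le_div_iff₀ h3, mul_comm]
        exact h2
      have hlim : Filter.Tendsto (fun n : ℕ => C * (ρ / r₀) ^ n * ‖y‖) Filter.atTop (nhds 0) := by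
        simpa using ((tendsto_pow_atTop_nhds_zero_of_lt_one (div_nonneg hρ hr0.le)
          ((div_lt_one hr0).2 hρr)).const_mul C).mul_const ‖y‖
      have hy0 : y = 0 := norm_le_zero_iff.1 (ge_of_tendsto' hlim hle)
      exact (sub_eq_zero.1 hy0).symm
    · rintro ⟨c, rfl⟩
      rw [map_smul, hu, smul_comm]
  have hu0 : ∀ i, u i ≠ 0 := fun i h => by
    have := hψu i i
    simp [h] at this
  refine ⟨m, lam, fun _ => 1, fun i => Submodule.span ℂ {u i}, H, hm, fun _ => le_rfl,
    fun i => (hspan i).symm, ?_, fun i => ⟨hlamr i, inferInstance, ?_⟩, ?_, ?_, ?_⟩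
  · constructor
    · rw [← AddMonoidHom.coe_coe, injective_iff_map_eq_zero]
      intro z hz
      have hz' : (z none : E) + ∑ i, (z (some i) : E) = 0 := by
        rw [← DirectSum.sum_univ_of z, AddMonoidHom.coe_coe, map_sum] at hz
        simpa only [DirectSum.coeAddMonoidHom_of, Fintype.sum_option] using hz
      have hc : ∀ i, ∃ c : ℂ, c • u i = z (some i) := fun i =>
        Submodule.mem_span_singleton.1 (z (some i)).2
      choose c hc using hc
      have hn : ∀ i, ψ i (z none) = 0 := (memH _).1 (z none).2
      -- Applying `ψ i` to the vanishing sum isolates the coefficient `c i`.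
      have hc0 : ∀ i, c i = 0 := by
        intro i
        have h1 := congrArg (ψ i) hz'
        simpa [← hc, hn, hψu] using h1
      have hs : ∀ i, (z (some i) : E) = 0 := fun i => by rw [← hc, hc0, zero_smul]
      ext o
      cases o with
      | none => simpa [hs] using hz'
      | some i => exact hs i
    · intro x
      have hx : x - ∑ i, ψ i x • u i ∈ H := by
        rw [memH]
        intro i
        simp [hψu]
      refine ⟨DirectSum.of (fun o : Option (Fin m) =>
          ((o.elim H fun i => Submodule.span ℂ {u i} : Submodule ℂ E))) none ⟨_, hx⟩ +
        ∑ i, DirectSum.of (fun o : Option (Fin m) =>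
          ((o.elim H fun i => Submodule.span ℂ {u i} : Submodule ℂ E))) (some i)
          ⟨ψ i x • u i, Submodule.smul_mem _ _ (Submodule.mem_span_singleton_self _)⟩, ?_⟩
      simp only [map_add, map_sum, DirectSum.coeAddMonoidHom_of]
      exact sub_add_cancel _ _
  · exact (finrank_span_singleton (hu0 i)).ge
  · have : (H : Set E) = ⋂ i, (ψ i) ⁻¹' {0} := by
      ext x
      simp [memH]
    rw [this]
    exact isClosed_iInter fun i => isClosed_singleton.preimage (ψ i).continuous
  · intro x hx
    rw [memH] at hx ⊢
    intro i
    rw [hψ, hx, mul_zero]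
  -- The sign of `C` is not assumed, hence `|C|`; a single good `n` then bounds the infimum.
  · have hnorm : ∀ n : ℕ, ‖(T ^ n).comp H.subtypeL‖ ≤ |C| * ρ ^ n := fun n =>
      ContinuousLinearMap.opNorm_le_bound _ (by positivity) fun x =>
        (hdecay x ((memH _).1 x.2) n).trans (by
          gcongr
          · exact le_abs_self C
          · exact le_rfl)
    obtain ⟨n, hn⟩ := exists_pow_mul_rpow_inv_lt (abs_nonneg C) hρ hρr
    have hn' := (Real.rpow_le_rpow (norm_nonneg ((T ^ (n : ℕ)).comp H.subtypeL)) (hnorm n)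
      (by positivity : (0 : ℝ) ≤ 1 / (n : ℕ))).trans_lt hn
    refine lt_of_le_of_lt (ciInf_le ⟨0, ?_⟩ n) hn'
    rintro _ ⟨k, rfl⟩
    exact Real.rpow_nonneg (norm_nonneg ((T ^ (k : ℕ)).comp H.subtypeL)) _

/-- Iterates of a rank-two perturbation `T = S + α(·) u + β(·) v`, where `u` and `v` are
eigenvectors of `T` for `1` and `μ`. -/
theorem exists_coeff_pow (T S : E →L[ℂ] E) (α β : E →L[ℂ] ℂ) (u v : E) (μ : ℂ)
    (hT : ∀ x, T x = S x + α x • u + β x • v) (hu : T u = u) (hv : T v = μ • v) (x : E) :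
    ∃ A B : ℕ → ℂ, B 0 = 0 ∧ (∀ n, B (n + 1) = μ * B n + β ((S ^ n) x)) ∧
      ∀ n, (T ^ n) x = (S ^ n) x + A n • u + B n • v := by
  let A : ℕ → ℂ := fun n => Nat.rec 0 (fun n t => t + α ((S ^ n) x)) n
  let B : ℕ → ℂ := fun n => Nat.rec 0 (fun n t => μ * t + β ((S ^ n) x)) n
  refine ⟨A, B, rfl, fun n => rfl, fun n => ?_⟩
  induction n with
  | zero => simp [A, B]
  | succ n ih =>
    have hA : A (n + 1) = A n + α ((S ^ n) x) := rfl
    have hB : B (n + 1) = μ * B n + β ((S ^ n) x) := rfl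
    -- The perturbation formula is used only on `S^n x`; on `u` and `v` the operator acts by its
    -- eigenvalues.
    rw [pow_succ', mul_apply_eq_comp, ih, map_add, map_add, map_smul, map_smul, hu, hv,
      hT, pow_succ' S, mul_apply_eq_comp, hA, hB]
    module

theorem norm_pow_apply_le {S : E →L[ℂ] E} {r : ℝ} (hS : ‖S‖ ≤ r) (n : ℕ) (x : E) :
    ‖(S ^ n) x‖ ≤ r ^ n * ‖x‖ := by
  induction n with
  | zero => simp
  | succ n ih =>
    rw [pow_succ', mul_apply_eq_comp, pow_succ', mul_assoc]
    exact (S.le_opNorm _).trans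
      (mul_le_mul hS ih (norm_nonneg _) ((norm_nonneg _).trans hS))

theorem apply_pow_eq {T : E →L[ℂ] E} {ψ : E →L[ℂ] ℂ} {lam : ℂ} (hψ : ∀ x, ψ (T x) = lam * ψ x)
    (n : ℕ) (x : E) : ψ ((T ^ n) x) = lam ^ n * ψ x := by
  induction n with
  | zero => simp
  | succ n ih => rw [pow_succ', mul_apply_eq_comp, hψ, ih, pow_succ', mul_assoc]

/-- Geometric convergence to the eigenprojection of the eigenvalue `1`. -/
theorem exists_norm_pow_sub_le (T S : E →L[ℂ] E) (α β ψ : E →L[ℂ] ℂ) (u v : E) (μ : ℂ)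
    (hT : ∀ x, T x = S x + α x • u + β x • v) (hu : T u = u) (hv : T v = μ • v)
    (hψ : ∀ x, ψ (T x) = ψ x) (hψu : ψ u = 1) (hψv : ψ v = 0) {r ρ : ℝ} (hS : ‖S‖ ≤ r)
    (hrρ : r ≤ ρ) (hμρ : ‖μ‖ < ρ) :
    ∃ C : ℝ, ∀ (n : ℕ) (x : E), ‖(T ^ n) x - ψ x • u‖ ≤ C * ρ ^ n * ‖x‖ := by
  have hρ : 0 < ρ := (norm_nonneg μ).trans_lt hμρ
  refine ⟨1 + ‖ψ‖ * ‖u‖ + ‖β‖ / (ρ - ‖μ‖) * ‖v‖, fun n x => ?_⟩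
  obtain ⟨A, B, hB0, hB, hx⟩ := exists_coeff_pow T S α β u v μ hT hu hv x
  have hSn : ∀ n, ‖(S ^ n) x‖ ≤ ρ ^ n * ‖x‖ := fun n =>
    norm_pow_apply_le (hS.trans hrρ) n x
  -- The constant `K = ‖β‖ / (ρ - ‖μ‖)` solves `‖μ‖ K + ‖β‖ = ρ K`, so the bound reproduces itself
  -- along the recursion.
  have hBn : ‖B n‖ ≤ ‖β‖ / (ρ - ‖μ‖) * ρ ^ n * ‖x‖ := by
    have hd : 0 < ρ - ‖μ‖ := sub_pos.2 hμρ
    induction n with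
    | zero =>
      rw [hB0, norm_zero]
      positivity
    | succ n ih =>
      rw [hB]
      calc ‖μ * B n + β ((S ^ n) x)‖
          ≤ ‖μ‖ * (‖β‖ / (ρ - ‖μ‖) * ρ ^ n * ‖x‖) + ‖β‖ * (ρ ^ n * ‖x‖) := by
            refine (norm_add_le _ _).trans (add_le_add ?_ ?_)
            · rw [norm_mul]
              gcongr
            · exact (β.le_opNorm _).trans (by gcongr; exact hSn n)
        _ = ‖β‖ / (ρ - ‖μ‖) * ρ ^ (n + 1) * ‖x‖ := by
            field_simp
            ring
  -- Invariance of `ψ` determines `A n` exactly, so its recursion is not needed.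
  have hA : A n = ψ x - ψ ((S ^ n) x) := by
    have h1 := apply_pow_eq (lam := 1) (by simpa using hψ) n x
    rw [hx n] at h1
    simp only [map_add, map_smul, smul_eq_mul, hψu, hψv] at h1
    linear_combination h1
  have e : (T ^ n) x - ψ x • u = (S ^ n) x + (-(ψ ((S ^ n) x)) • u + B n • v) := by
    rw [hx n, hA]
    module
  rw [e]
  have h1 : ‖ψ ((S ^ n) x)‖ ≤ ‖ψ‖ * (ρ ^ n * ‖x‖) :=
    (ψ.le_opNorm _).trans (by gcongr; exact hSn n)
  calc _ ≤ ‖(S ^ n) x‖ + (‖ψ ((S ^ n) x)‖ * ‖u‖ + ‖B n‖ * ‖v‖) := by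
        refine (norm_add_le _ _).trans (add_le_add_right ((norm_add_le _ _).trans_eq ?_) _)
        rw [norm_smul, norm_smul, norm_neg]
    _ ≤ ρ ^ n * ‖x‖ + (‖ψ‖ * (ρ ^ n * ‖x‖) * ‖u‖ + ‖β‖ / (ρ - ‖μ‖) * ρ ^ n * ‖x‖ * ‖v‖) := by
        gcongr
        exact hSn n
    _ = _ := by ring

/-- Geometric decay on the common kernel of the two left eigenfunctionals. -/
theorem exists_norm_pow_le (T S : E →L[ℂ] E) (α β ψ χ : E →L[ℂ] ℂ) (u v : E) (μ : ℂ)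
    (hT : ∀ x, T x = S x + α x • u + β x • v) (hu : T u = u) (hv : T v = μ • v)
    (hψ : ∀ x, ψ (T x) = ψ x) (hψu : ψ u = 1) (hψv : ψ v = 0)
    (hχ : ∀ x, χ (T x) = μ * χ x) (hχu : χ u = 0) (hχv : χ v = 1) {r : ℝ} (hS : ‖S‖ ≤ r) :
    ∃ C : ℝ, ∀ x, ψ x = 0 → χ x = 0 → ∀ n : ℕ, ‖(T ^ n) x‖ ≤ C * r ^ n * ‖x‖ := by
  refine ⟨1 + ‖ψ‖ * ‖u‖ + ‖χ‖ * ‖v‖, fun x hψx hχx n => ?_⟩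
  obtain ⟨A, B, -, -, hx⟩ := exists_coeff_pow T S α β u v μ hT hu hv x
  have hSn : ‖(S ^ n) x‖ ≤ r ^ n * ‖x‖ := norm_pow_apply_le hS n x
  -- Both coefficients are now values of fixed functionals at `S^n x`. The rate is therefore `r`
  -- itself, even if `r < ‖μ‖`.
  have hA : A n = -ψ ((S ^ n) x) := by
    have h1 := apply_pow_eq (lam := 1) (by simpa using hψ) n x
    rw [hx n] at h1
    simp only [map_add, map_smul, smul_eq_mul, hψu, hψv, hψx] at h1
    linear_combination h1
  have hB : B n = -χ ((S ^ n) x) := by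
    have h1 := apply_pow_eq hχ n x
    rw [hx n] at h1
    simp only [map_add, map_smul, smul_eq_mul, hχu, hχv, hχx] at h1
    linear_combination h1
  rw [hx n, hA, hB]
  have h1 : ‖ψ ((S ^ n) x)‖ ≤ ‖ψ‖ * (r ^ n * ‖x‖) := (ψ.le_opNorm _).trans (by gcongr)
  have h2 : ‖χ ((S ^ n) x)‖ ≤ ‖χ‖ * (r ^ n * ‖x‖) := (χ.le_opNorm _).trans (by gcongr)
  calc _ ≤ ‖(S ^ n) x‖ + ‖ψ ((S ^ n) x)‖ * ‖u‖ + ‖χ ((S ^ n) x)‖ * ‖v‖ := by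
        refine (norm_add₃_le).trans_eq ?_
        rw [norm_smul, norm_smul, norm_neg, norm_neg]
    _ ≤ r ^ n * ‖x‖ + ‖ψ‖ * (r ^ n * ‖x‖) * ‖u‖ + ‖χ‖ * (r ^ n * ‖x‖) * ‖v‖ := by
        gcongr
    _ = _ := by ring

end Abstract

/-! ### Functionals, test vectors and the weighted shift on the weighted space. -/

namespace WeightedSpace

variable {V : Weight}

/-- The functional `f ↦ ∑ w n * f n` given by a real sequence with `∑ |w n| V n < ∞`. -/
noncomputable def functional (w : ℕ → ℝ) (hw : Summable fun n => |w n| * V.val n) :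
    WeightedSpace V →L[ℂ] ℂ :=
  have hle : ∀ (f : WeightedSpace V) (n : ℕ), ‖(w n : ℂ) * f n‖ ≤ ‖f‖ * (|w n| * V.val n) := by
    intro f n
    rw [norm_mul, Complex.norm_real, Real.norm_eq_abs, mul_left_comm]
    exact mul_le_mul_of_nonneg_left (f.apply_le_norm n) (abs_nonneg _)
  have hs : ∀ f : WeightedSpace V, Summable fun n => (w n : ℂ) * f n := fun f =>
    Summable.of_norm_bounded (hw.mul_left ‖f‖) (hle f)
  LinearMap.mkContinuous
    { toFun := fun f => ∑' n, (w n : ℂ) * f n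
      map_add' := fun f g => by
        simp only [add_apply, mul_add]
        exact (hs f).tsum_add (hs g)
      map_smul' := fun c f => by
        simp only [smul_apply, RingHom.id_apply, smul_eq_mul, mul_left_comm _ c]
        exact tsum_mul_left }
    (∑' n, |w n| * V.val n) fun f => by
      rw [mul_comm]
      exact tsum_of_norm_bounded (hw.hasSum.mul_left ‖f‖) (hle f)

theorem functional_hasSum (w : ℕ → ℝ) (hw : Summable fun n => |w n| * V.val n)
    (f : WeightedSpace V) : HasSum (fun n => (w n : ℂ) * f n) (functional w hw f) := by
  refine Summable.hasSum (Summable.of_norm_bounded (hw.mul_left ‖f‖) fun n => ?_)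
  rw [norm_mul, Complex.norm_real, Real.norm_eq_abs, mul_left_comm]
  exact mul_le_mul_of_nonneg_left (f.apply_le_norm n) (abs_nonneg _)

variable (V) in
/-- The evaluation at `0`. -/
noncomputable def evalZero : WeightedSpace V →L[ℂ] ℂ :=
  LinearMap.mkContinuous
    { toFun := fun f => f 0
      map_add' := fun _ _ => rfl
      map_smul' := fun _ _ => rfl }
    (V.val 0) fun f => by
      rw [mul_comm]
      exact f.apply_le_norm 0

@[simp] theorem evalZero_apply (f : WeightedSpace V) : evalZero V f = f 0 := rfl

@[simp] theorem one_apply (n : ℕ) : one V n = 1 := rfl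

variable (V) in
/-- The function with value `1` at `0` and `-p` elsewhere. -/
noncomputable def twoValued (p : ℝ) : WeightedSpace V :=
  mk (fun n => if n = 0 then 1 else -(p : ℂ)) ⟨1 + |p|, by
    rintro _ ⟨n, rfl⟩
    refine (div_le_self (norm_nonneg _) (V.one_le n)).trans ?_
    split_ifs
    · simp
    · rw [norm_neg, Complex.norm_real, Real.norm_eq_abs]
      linarith⟩

@[simp] theorem twoValued_zero (p : ℝ) : twoValued V p 0 = 1 := rfl

@[simp] theorem twoValued_succ (p : ℝ) (n : ℕ) : twoValued V p (n + 1) = -(p : ℂ) := rfl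

theorem shift_bound {γ : ℝ} (hγ : 1 < γ) {q : ℝ} (hq : 0 ≤ q)
    (f : WeightedSpace (geomWeight γ hγ)) (n : ℕ) :
    ‖(if n = 0 then 0 else (q : ℂ) * f (n + 1) : ℂ)‖ ≤ q * γ * ‖f‖ * (geomWeight γ hγ).val n := by
  have hγ0 : 0 < γ := one_pos.trans hγ
  have hV : ∀ n, (geomWeight γ hγ).val n = γ ^ n := fun _ => rfl
  split_ifs
  · rw [norm_zero, hV]
    positivity
  · rw [norm_mul, Complex.norm_real, Real.norm_of_nonneg hq, hV]
    have h1 := f.apply_le_norm (n + 1)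
    rw [hV] at h1
    calc q * ‖f (n + 1)‖ ≤ q * (‖f‖ * γ ^ (n + 1)) := mul_le_mul_of_nonneg_left h1 hq
      _ = _ := by ring

/-- The weighted shift `f ↦ q f(· + 1)` killed at `0`. -/
noncomputable def shift {γ : ℝ} (hγ : 1 < γ) {q : ℝ} (hq : 0 ≤ q) :
    WeightedSpace (geomWeight γ hγ) →L[ℂ] WeightedSpace (geomWeight γ hγ) :=
  LinearMap.mkContinuous
    { toFun := fun f => mk (fun n => if n = 0 then 0 else (q : ℂ) * f (n + 1))
        ⟨q * γ * ‖f‖, by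
          rintro _ ⟨n, rfl⟩
          exact (div_le_iff₀ ((geomWeight γ hγ).pos n)).2 (shift_bound hγ hq f n)⟩
      map_add' := fun f g => ext' fun n => by
        change (if n = 0 then 0 else (q : ℂ) * (f (n + 1) + g (n + 1))) =
          (if n = 0 then 0 else (q : ℂ) * f (n + 1)) + (if n = 0 then 0 else (q : ℂ) * g (n + 1))
        split_ifs <;> ring
      map_smul' := fun c f => ext' fun n => by
        change (if n = 0 then 0 else (q : ℂ) * (c * f (n + 1))) =
          c * (if n = 0 then 0 else (q : ℂ) * f (n + 1))
        split_ifs <;> ring }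
    (q * γ) fun f => norm_le_of _ fun n => shift_bound hγ hq f n

theorem shift_zero {γ : ℝ} (hγ : 1 < γ) {q : ℝ} (hq : 0 ≤ q)
    (f : WeightedSpace (geomWeight γ hγ)) : shift hγ hq f 0 = 0 := rfl

theorem shift_succ {γ : ℝ} (hγ : 1 < γ) {q : ℝ} (hq : 0 ≤ q)
    (f : WeightedSpace (geomWeight γ hγ)) (n : ℕ) :
    shift hγ hq f (n + 1) = (q : ℂ) * f (n + 2) := rfl

theorem norm_shift_le {γ : ℝ} (hγ : 1 < γ) {q : ℝ} (hq : 0 ≤ q) : ‖shift hγ hq‖ ≤ q * γ :=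
  LinearMap.mkContinuous_norm_le _ (by have := one_pos.trans hγ; positivity) _

end WeightedSpace

/-! ### Left eigensequences: summability and total mass. -/

/-- The solution `ψ 0 = 1`, `l ψ (n + 1) = a (n + 1) + q ψ n` (without the term `q ψ 0`) of the
left eigenvector equation of the walk. -/
noncomputable def leftEigen (q l : ℝ) (a : ℕ → ℝ) : ℕ → ℝ
  | 0 => 1
  | 1 => l⁻¹ * a 1
  | n + 2 => l⁻¹ * (a (n + 2) + q * leftEigen q l a (n + 1))

/-- Summing the recursion bounds the partial sums by `X_{n+1} ≤ ∑ b + θ X_n`. Since `X_n ≤ X_{n+1}`,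
this gives `(1 - θ) X_n ≤ ∑ b`. -/
theorem summable_of_le_geometric_recursion {x b : ℕ → ℝ} {θ : ℝ} (hx : ∀ n, 0 ≤ x n)
    (hb : ∀ n, 0 ≤ b n) (hbs : Summable b) (hθ : θ < 1) (h0 : x 0 ≤ b 0)
    (h : ∀ n, x (n + 1) ≤ b (n + 1) + θ * x n) : Summable x := by
  have key : ∀ n, ∑ i ∈ Finset.range (n + 1), x i ≤
      ∑ i ∈ Finset.range (n + 1), b i + θ * ∑ i ∈ Finset.range n, x i := by
    intro n
    induction n with
    | zero => simpa using h0
    | succ n ih =>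
      rw [Finset.sum_range_succ x (n + 1), Finset.sum_range_succ b (n + 1),
        Finset.sum_range_succ x n] at *
      linarith [h n]
  refine summable_of_sum_range_le (c := (∑' i, b i) / (1 - θ)) hx fun n => ?_
  rw [le_div_iff₀ (sub_pos.2 hθ)]
  have h1 := key n
  have h2 : ∑ i ∈ Finset.range (n + 1), b i ≤ ∑' i, b i := hbs.sum_le_tsum _ fun i _ => hb i
  have h3 : ∑ i ∈ Finset.range n, x i ≤ ∑ i ∈ Finset.range (n + 1), x i :=
    Finset.sum_le_sum_of_subset_of_nonneg (Finset.range_subset_range.2 n.le_succ) fun i _ _ => hx i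
  linarith

/-- The weighted terms obey a recursion with ratio `qγ / |l|`. The condition `qγ < |l|` is what
makes the left eigenfunctional bounded on the space. -/
theorem summable_abs_leftEigen {q l γ : ℝ} {a : ℕ → ℝ} (hq : 0 ≤ q) (hγ : 1 < γ)
    (ha : ∀ n, 1 ≤ n → 0 ≤ a n) (hs : Summable fun n => a (n + 1) * γ ^ (n + 1))
    (hl : q * γ < |l|) : Summable fun n => |leftEigen q l a n| * γ ^ n := by
  have hγ0 : 0 < γ := one_pos.trans hγ
  have hl0 : 0 < |l| := lt_of_le_of_lt (by positivity) hl
  rw [← summable_nat_add_iff 1]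
  refine summable_of_le_geometric_recursion (b := fun n => |l|⁻¹ * (a (n + 1) * γ ^ (n + 1)))
    (θ := q * γ / |l|) (fun n => by positivity) (fun n => ?_) (hs.mul_left _)
    ((div_lt_one hl0).2 hl) ?_ (fun n => ?_)
  · have := ha (n + 1) (by omega)
    positivity
  · simp only [zero_add, leftEigen]
    rw [abs_mul, abs_inv, abs_of_nonneg (ha 1 le_rfl), mul_assoc]
  · have h1 := ha (n + 2) (by omega)
    simp only [leftEigen]
    rw [abs_mul, abs_inv]
    have h2 : |a (n + 2) + q * leftEigen q l a (n + 1)| ≤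
        a (n + 2) + q * |leftEigen q l a (n + 1)| := by
      refine (abs_add_le _ _).trans_eq ?_
      rw [abs_of_nonneg h1, abs_mul, abs_of_nonneg hq]
    calc |l|⁻¹ * |a (n + 2) + q * leftEigen q l a (n + 1)| * γ ^ (n + 1 + 1)
        ≤ |l|⁻¹ * (a (n + 2) + q * |leftEigen q l a (n + 1)|) * γ ^ (n + 1 + 1) := by gcongr
      _ = _ := by ring

theorem leftEigen_nonneg {q l : ℝ} {a : ℕ → ℝ} (hq : 0 ≤ q) (hl : 0 ≤ l)
    (ha : ∀ n, 1 ≤ n → 0 ≤ a n) : ∀ n, 0 ≤ leftEigen q l a n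
  | 0 => zero_le_one
  | 1 => mul_nonneg (inv_nonneg.2 hl) (ha 1 le_rfl)
  | n + 2 => mul_nonneg (inv_nonneg.2 hl)
    (add_nonneg (ha _ (by omega)) (mul_nonneg hq (leftEigen_nonneg hq hl ha (n + 1))))

/-- Summing the recursion over all indices `≥ 1`, the mass `t` satisfies `l t = 1 + q t`. -/
theorem hasSum_leftEigen_succ {q l : ℝ} {a : ℕ → ℝ} (hl : l ≠ 0) (hlq : l ≠ q)
    (hsum : HasSum (fun n => a (n + 1)) 1) (hs : Summable (leftEigen q l a)) :
    HasSum (fun n => leftEigen q l a (n + 1)) (1 / (l - q)) := by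
  have hs1 : Summable fun n => leftEigen q l a (n + 1) := (summable_nat_add_iff 1).2 hs
  obtain ⟨t, ht⟩ := hs1
  have h1 : HasSum (fun n => leftEigen q l a (n + 2)) (t - leftEigen q l a 1) := by
    simpa using (hasSum_nat_add_iff' 1).2 ht
  have h2 : HasSum (fun n => a (n + 2)) (1 - a 1) := by
    simpa using (hasSum_nat_add_iff' 1).2 hsum
  have h3 : HasSum (fun n => leftEigen q l a (n + 2)) (l⁻¹ * ((1 - a 1) + q * t)) :=
    (h2.add (ht.mul_left q)).mul_left l⁻¹
  have h4 := h1.unique h3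
  have h5 : t = 1 / (l - q) := by
    rw [eq_div_iff (sub_ne_zero.2 hlq)]
    simp only [leftEigen] at h4
    field_simp at h4
    linarith
  rwa [h5] at ht

open WeightedSpace

/-! ### The walk operator as the shift plus a rank-two term. -/

section Walk

variable {p : ℝ} {a : ℕ → ℝ} {γ : ℝ}

theorem summable_walkProb_zero (ha : ∀ n, 1 ≤ n → a n ∈ Icc (0 : ℝ) 1) (hγ : 1 < γ)
    (hγsum : Summable fun n => a (n + 1) * γ ^ (n + 1)) :
    Summable fun n => |walkProb p a 0 n| * (geomWeight γ hγ).val n := by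
  rw [← summable_nat_add_iff 1]
  refine hγsum.congr fun n => ?_
  simp [walkProb, geomWeight, abs_of_nonneg (ha (n + 1) (by omega)).1]

theorem hasSum_walkProb_succ (p : ℝ) (a : ℕ → ℝ) (f : ℕ → ℂ) (n : ℕ) :
    HasSum (fun j => (walkProb p a (n + 1) j : ℂ) * f j)
      ((p : ℂ) * f 0 + ((1 - p : ℝ) : ℂ) * f (n + 2)) := by
  have h := hasSum_sum_of_ne_finset_zero (f := fun j => (walkProb p a (n + 1) j : ℂ) * f j)
    (s := {0, n + 2}) (L := SummationFilter.unconditional ℕ) (by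
      intro j hj
      simp only [Finset.mem_insert, Finset.mem_singleton, not_or] at hj
      simp [walkProb, hj.1, hj.2])
  rw [Finset.sum_pair (by omega)] at h
  simpa [walkProb] using h

theorem walk_actsOn (hp : p ∈ Ioo (0 : ℝ) 1) (ha : ∀ n, 1 ≤ n → a n ∈ Icc (0 : ℝ) 1)
    (hsum : HasSum (fun n => a (n + 1)) 1) (hγ : 1 < γ)
    (hγsum : Summable fun n => a (n + 1) * γ ^ (n + 1)) :
    (walk p hp a ha hsum).ActsOn (geomWeight γ hγ) := by
  have hγ0 : 0 < γ := one_pos.trans hγ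
  have hs : ∀ n, HasSum (fun j => walkProb p a (n + 1) j * γ ^ j) (p + (1 - p) * γ ^ (n + 2)) := by
    intro n
    have h := hasSum_walkProb_succ p a (fun j => (γ : ℂ) ^ j) n
    rw [← Complex.hasSum_ofReal]
    push_cast at h ⊢
    simpa using h
  -- From `n ≥ 1` the ratio `(PV)(n) / V(n)` is `p γ^(-n) + qγ ≤ p + qγ`; row `0` uses the moment
  -- assumption.
  refine ⟨fun n => ?_, max (∑' j, walkProb p a 0 j * γ ^ j) (p + (1 - p) * γ), ?_⟩
  · cases n with
    | zero =>
      refine (summable_walkProb_zero (p := p) ha hγ hγsum).congr fun n => ?_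
      rw [abs_of_nonneg (show 0 ≤ walkProb p a 0 n from (walk p hp a ha hsum).nonneg 0 n)]
      rfl
    | succ n => exact (hs n).summable
  · rintro _ ⟨n, rfl⟩
    cases n with
    | zero =>
      refine le_max_of_le_left (le_of_eq ?_)
      simp [geomWeight, walk]
    | succ n =>
      refine le_max_of_le_right ?_
      change (∑' j, walkProb p a (n + 1) j * γ ^ j) / γ ^ (n + 1) ≤ _
      rw [(hs n).tsum_eq, div_le_iff₀ (by positivity)]
      have h1 : 1 ≤ γ ^ (n + 1) := one_le_pow₀ hγ.le
      have h2 : p ≤ p * γ ^ (n + 1) := le_mul_of_one_le_right hp.1.le h1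
      calc p + (1 - p) * γ ^ (n + 2) ≤ p * γ ^ (n + 1) + (1 - p) * γ ^ (n + 2) := by linarith
        _ = _ := by ring

variable (hp : p ∈ Ioo (0 : ℝ) 1) (ha : ∀ n, 1 ≤ n → a n ∈ Icc (0 : ℝ) 1)
  (hsum : HasSum (fun n => a (n + 1)) 1) (hγ : 1 < γ)
  (hγsum : Summable fun n => a (n + 1) * γ ^ (n + 1))
  (h : (walk p hp a ha hsum).ActsOn (geomWeight γ hγ))

theorem walk_op_zero (f : WeightedSpace (geomWeight γ hγ)) :
    (walk p hp a ha hsum).op (geomWeight γ hγ) h f 0 =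
      functional (walkProb p a 0) (summable_walkProb_zero ha hγ hγsum) f := rfl

theorem walk_op_succ (f : WeightedSpace (geomWeight γ hγ)) (n : ℕ) :
    (walk p hp a ha hsum).op (geomWeight γ hγ) h f (n + 1) =
      (p : ℂ) * f 0 + ((1 - p : ℝ) : ℂ) * f (n + 2) :=
  (hasSum_walkProb_succ p a f n).tsum_eq

theorem one_add_ofReal_ne_zero (hp : p ∈ Ioo (0 : ℝ) 1) : (1 + p : ℂ) ≠ 0 := by
  have : (1 + p : ℝ) ≠ 0 := by linarith [hp.1]
  exact_mod_cast this

theorem walk_op_one :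
    (walk p hp a ha hsum).op (geomWeight γ hγ) h (one _) = one _ := by
  refine WeightedSpace.ext' fun n => ?_
  rw [MarkovMatrix.op_apply]
  simp only [one_apply, mul_one]
  have h1 := Complex.hasSum_ofReal.2 ((walk p hp a ha hsum).hasSum_one n)
  simpa using h1.tsum_eq

/-- On functions equal to `s` at `0` and `t` elsewhere, the kernel acts by `(s, t) ↦ (t, p s + q
t)`, with eigenvalues `1` and `-p`. -/
theorem walk_op_twoValued (hγsum : Summable fun n => a (n + 1) * γ ^ (n + 1)) :
    (walk p hp a ha hsum).op (geomWeight γ hγ) h (twoValued _ p) =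
      ((-p : ℝ) : ℂ) • twoValued _ p := by
  refine WeightedSpace.ext' fun n => ?_
  cases n with
  | zero =>
    rw [walk_op_zero hp ha hsum hγ hγsum h]
    have h1 := functional_hasSum (walkProb p a 0) (summable_walkProb_zero ha hγ hγsum)
      (twoValued _ p)
    refine h1.unique ?_
    rw [← hasSum_nat_add_iff' 1, smul_apply]
    simpa [walkProb] using (Complex.hasSum_ofReal.2 hsum).mul_right (-(p : ℂ))
  | succ n =>
    rw [walk_op_succ, smul_apply]
    simp
    ring

/-- The coefficient of the constant `1` in the rank-two part of the walk operator. -/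
noncomputable def coeffOne : WeightedSpace (geomWeight γ hγ) →L[ℂ] ℂ :=
  (p / (1 + p) : ℂ) •
    (functional (walkProb p a 0) (summable_walkProb_zero ha hγ hγsum) + evalZero _)

/-- The coefficient of `twoValued p` in the rank-two part of the walk operator. -/
noncomputable def coeffTwoValued : WeightedSpace (geomWeight γ hγ) →L[ℂ] ℂ :=
  (1 / (1 + p) : ℂ) •
    (functional (walkProb p a 0) (summable_walkProb_zero ha hγ hγsum) - (p : ℂ) • evalZero _)

theorem coeffOne_apply (f : WeightedSpace (geomWeight γ hγ)) :
    coeffOne (p := p) ha hγ hγsum f = (p / (1 + p) : ℂ) *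
      (functional (walkProb p a 0) (summable_walkProb_zero ha hγ hγsum) f + f 0) := rfl

theorem coeffTwoValued_apply (f : WeightedSpace (geomWeight γ hγ)) :
    coeffTwoValued (p := p) ha hγ hγsum f = (1 / (1 + p) : ℂ) *
      (functional (walkProb p a 0) (summable_walkProb_zero ha hγ hγsum) f - p * f 0) := rfl

/-- With `φ(f) = ∑ a n f(n)` over `n ≥ 1`, the difference from the shift is `φ(f)` at `0` and `p
f(0)` elsewhere. The two coefficients solve `c + d = φ(f)`, `c - p d = p f(0)`. -/
theorem walk_op_eq (f : WeightedSpace (geomWeight γ hγ)) :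
    (walk p hp a ha hsum).op (geomWeight γ hγ) h f =
      shift hγ (sub_nonneg.2 hp.2.le) f + coeffOne (p := p) ha hγ hγsum f • one _ +
      coeffTwoValued (p := p) ha hγ hγsum f • twoValued _ p := by
  have hne := one_add_ofReal_ne_zero hp
  refine WeightedSpace.ext' fun n => ?_
  cases n with
  | zero =>
    rw [walk_op_zero hp ha hsum hγ hγsum h]
    simp only [add_apply, smul_apply, shift_zero, one_apply, twoValued_zero, coeffOne_apply,
      coeffTwoValued_apply]
    field_simp
    ring
  | succ n =>
    rw [walk_op_succ]
    simp only [add_apply, smul_apply, shift_succ, one_apply, twoValued_succ, coeffOne_apply,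
      coeffTwoValued_apply]
    field_simp
    ring

theorem functional_leftEigen_shift {l : ℝ} (hl0 : l ≠ 0)
    (hs : Summable fun n => |leftEigen (1 - p) l a n| * (geomWeight γ hγ).val n)
    (f : WeightedSpace (geomWeight γ hγ)) :
    functional _ hs (shift hγ (sub_nonneg.2 hp.2.le) f) =
      l * (functional _ hs f - f 0) -
        functional (walkProb p a 0) (summable_walkProb_zero ha hγ hγsum) f := by
  -- The shift lowers the index by one, so one term is dropped here and two in the other sums; the
  -- recursion then matches the tails termwise.
  have h1 := (hasSum_nat_add_iff' 1).2
    (functional_hasSum _ hs (shift hγ (sub_nonneg.2 hp.2.le) f))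
  have h2 := (hasSum_nat_add_iff' 2).2 (functional_hasSum _ hs f)
  have h3 := (hasSum_nat_add_iff' 2).2
    (functional_hasSum _ (summable_walkProb_zero (p := p) ha hγ hγsum) f)
  have e : (fun n => (walkProb p a 0 (n + 2) : ℂ) * f (n + 2) +
      (leftEigen (1 - p) l a (n + 1) : ℂ) * shift hγ (sub_nonneg.2 hp.2.le) f (n + 1)) =
      fun n => (l : ℂ) * ((leftEigen (1 - p) l a (n + 2) : ℂ) * f (n + 2)) := by
    funext n
    have hrec : l * leftEigen (1 - p) l a (n + 2) =
        a (n + 2) + (1 - p) * leftEigen (1 - p) l a (n + 1) := by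
      simp only [leftEigen]
      field_simp
    have hrec' := congrArg (fun x : ℝ => (x : ℂ)) hrec
    push_cast at hrec'
    rw [shift_succ, ← mul_assoc (l : ℂ), hrec']
    simp [walkProb]
    ring
  have h4 := h3.add h1
  rw [e] at h4
  have h5 := h4.unique (h2.mul_left (l : ℂ))
  have hl : (l : ℂ) ≠ 0 := by exact_mod_cast hl0
  simp [Finset.sum_range_succ, shift_zero, leftEigen, walkProb] at h5
  field_simp at h5
  linear_combination h5

theorem functional_leftEigen_const (hsum : HasSum (fun n => a (n + 1)) 1) {l : ℝ}
    (hl0 : l ≠ 0) (hlq : l ≠ 1 - p)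
    (hs : Summable fun n => |leftEigen (1 - p) l a n| * (geomWeight γ hγ).val n) (s t : ℂ)
    (f : WeightedSpace (geomWeight γ hγ)) (hf0 : f 0 = s) (hf : ∀ n, f (n + 1) = t) :
    functional _ hs f = s + t / ((l - (1 - p) : ℝ) : ℂ) := by
  have hs' : Summable (leftEigen (1 - p) l a) := Summable.of_norm_bounded hs fun n =>
    le_mul_of_one_le_right (abs_nonneg _) ((geomWeight γ hγ).one_le n)
  have h1 := Complex.hasSum_ofReal.2 (hasSum_leftEigen_succ hl0 hlq hsum hs')
  refine (functional_hasSum _ hs f).unique ?_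
  rw [← hasSum_nat_add_iff' 1]
  simp only [hf, Finset.sum_range_one, hf0, leftEigen]
  have e : s + t / ((l - (1 - p) : ℝ) : ℂ) - ((1 : ℝ) : ℂ) * s =
      ((1 / (l - (1 - p)) : ℝ) : ℂ) * t := by
    push_cast
    ring
  rw [e]
  exact h1.mul_right t

end Walk

/-! ### Left eigenfunctionals, the invariant measure and the decompositions. -/

section Walk

variable {p : ℝ} {a : ℕ → ℝ} {γ : ℝ}

variable (hp : p ∈ Ioo (0 : ℝ) 1) (ha : ∀ n, 1 ≤ n → a n ∈ Icc (0 : ℝ) 1)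
  (hsum : HasSum (fun n => a (n + 1)) 1) (hγ : 1 < γ)
  (hγsum : Summable fun n => a (n + 1) * γ ^ (n + 1))
  (h : (walk p hp a ha hsum).ActsOn (geomWeight γ hγ))

/-- For `l = 1` the functional takes the value `(1 + p) / p` at `1` and vanishes at `twoValued`. The
rank-two part thus contributes exactly the boundary terms lost by the shift. -/
theorem functional_leftEigen_one_op (hγsum : Summable fun n => a (n + 1) * γ ^ (n + 1))
    (hs : Summable fun n => |leftEigen (1 - p) 1 a n| * (geomWeight γ hγ).val n)
    (f : WeightedSpace (geomWeight γ hγ)) :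
    functional _ hs ((walk p hp a ha hsum).op (geomWeight γ hγ) h f) = functional _ hs f := by
  have hp0 : (p : ℂ) ≠ 0 := by exact_mod_cast hp.1.ne'
  have hne := one_add_ofReal_ne_zero hp
  have hlq : (1 : ℝ) ≠ 1 - p := by linarith [hp.1]
  rw [walk_op_eq hp ha hsum hγ hγsum h, map_add, map_add, map_smul, map_smul,
    functional_leftEigen_shift hp ha hγ hγsum one_ne_zero hs,
    functional_leftEigen_const hγ hsum one_ne_zero hlq hs 1 1 (one _) rfl (fun _ => rfl),
    functional_leftEigen_const hγ hsum one_ne_zero hlq hs 1 (-p) (twoValued _ p) rfl (fun _ => rfl),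
    coeffOne_apply, coeffTwoValued_apply]
  push_cast
  simp only [smul_eq_mul]
  have e : (1 - (1 - p) : ℂ) = p := by ring
  rw [e]
  field_simp
  ring

/-- For `l = -p` the roles swap: the functional vanishes at `1` and equals `1 + p` at `twoValued`.
-/
theorem functional_leftEigen_neg_op (hγsum : Summable fun n => a (n + 1) * γ ^ (n + 1))
    (hs : Summable fun n => |leftEigen (1 - p) (-p) a n| * (geomWeight γ hγ).val n)
    (f : WeightedSpace (geomWeight γ hγ)) :
    functional _ hs ((walk p hp a ha hsum).op (geomWeight γ hγ) h f) =
      ((-p : ℝ) : ℂ) * functional _ hs f := by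
  have hp0 : -p ≠ 0 := neg_ne_zero.2 hp.1.ne'
  have hne := one_add_ofReal_ne_zero hp
  have hlq : -p ≠ 1 - p := by linarith
  rw [walk_op_eq hp ha hsum hγ hγsum h, map_add, map_add, map_smul, map_smul,
    functional_leftEigen_shift hp ha hγ hγsum hp0 hs,
    functional_leftEigen_const hγ hsum hp0 hlq hs 1 1 (one _) rfl (fun _ => rfl),
    functional_leftEigen_const hγ hsum hp0 hlq hs 1 (-p) (twoValued _ p) rfl (fun _ => rfl),
    coeffOne_apply, coeffTwoValued_apply]
  push_cast
  simp only [smul_eq_mul]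
  have e : (-p - (1 - p) : ℂ) = -1 := by ring
  rw [e]
  field_simp
  ring

/-- The invariant probability measure of the walk. -/
noncomputable def walkInvariant (p : ℝ) (a : ℕ → ℝ) (n : ℕ) : ℝ :=
  p / (1 + p) * leftEigen (1 - p) 1 a n

theorem walkInvariant_isInvariantProb
    (hs : Summable fun n => |leftEigen (1 - p) 1 a n| * (geomWeight γ hγ).val n) :
    (walk p hp a ha hsum).IsInvariantProb (geomWeight γ hγ) (walkInvariant p a) := by
  have hp0 := hp.1
  have hnn : ∀ n, 0 ≤ leftEigen (1 - p) 1 a n :=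
    leftEigen_nonneg (sub_nonneg.2 hp.2.le) zero_le_one fun n hn => (ha n hn).1
  have hs' : Summable (leftEigen (1 - p) 1 a) := Summable.of_norm_bounded hs fun n =>
    le_mul_of_one_le_right (abs_nonneg _) ((geomWeight γ hγ).one_le n)
  have h1 := hasSum_leftEigen_succ one_ne_zero (by linarith : (1 : ℝ) ≠ 1 - p) hsum hs'
  rw [sub_sub_cancel] at h1
  refine ⟨fun i => mul_nonneg (by positivity) (hnn i), ?_, fun j => ?_, ?_⟩
  · have h2 := (hasSum_nat_add_iff 1).1 h1
    have h3 := h2.mul_left (p / (1 + p))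
    have e : p / (1 + p) * (1 / p + ∑ i ∈ Finset.range 1, leftEigen (1 - p) 1 a i) = 1 := by
      rw [Finset.sum_range_one, leftEigen]
      field_simp
    rwa [e] at h3
  · change HasSum (fun i => walkInvariant p a i * walkProb p a i j) _
    -- State `0` is entered from every `i ≥ 1`, state `1` only from `0`, and state `j + 2` only from
    -- `0` and `j + 1`.
    match j with
    | 0 =>
      rw [← hasSum_nat_add_iff' 1]
      have h3 := (h1.mul_left (p / (1 + p))).mul_right p
      have e : walkInvariant p a 0 - ∑ i ∈ Finset.range 1, walkInvariant p a i * walkProb p a i 0 =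
          p / (1 + p) * (1 / p) * p := by
        simp [walkInvariant, leftEigen, walkProb]
        field_simp
      rw [e]
      exact h3
    | 1 =>
      have h3 := hasSum_single (f := fun i => walkInvariant p a i * walkProb p a i 1) 0
        fun i hi => by simp [walkProb, hi]
      convert h3 using 1
      simp [walkInvariant, leftEigen, walkProb]
    | j + 2 =>
      have h3 := hasSum_sum_of_ne_finset_zero
        (f := fun i => walkInvariant p a i * walkProb p a i (j + 2))
        (s := {0, j + 1}) (L := SummationFilter.unconditional ℕ) (by
          intro i hi
          simp only [Finset.mem_insert, Finset.mem_singleton, not_or] at hi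
          have : j + 1 ≠ i := fun h => hi.2 h.symm
          simp [walkProb, hi.1, this])
      rw [Finset.sum_pair (by omega)] at h3
      convert h3 using 1
      simp [walkInvariant, leftEigen, walkProb]
      ring
  · refine (hs.mul_left (p / (1 + p))).congr fun n => ?_
    rw [abs_of_nonneg (hnn n), walkInvariant, mul_assoc]

/-- The functional of the invariant probability measure. -/
noncomputable def invariantFunctional
    (hs : Summable fun n => |leftEigen (1 - p) 1 a n| * (geomWeight γ hγ).val n) :
    WeightedSpace (geomWeight γ hγ) →L[ℂ] ℂ :=
  (p / (1 + p) : ℂ) • functional _ hs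

variable (hs : Summable fun n => |leftEigen (1 - p) 1 a n| * (geomWeight γ hγ).val n)

theorem invariantFunctional_apply (f : WeightedSpace (geomWeight γ hγ)) :
    invariantFunctional hγ hs f = (p / (1 + p) : ℂ) * functional _ hs f := rfl

theorem invariantFunctional_eq_tsum (f : WeightedSpace (geomWeight γ hγ)) :
    invariantFunctional hγ hs f = ∑' i, (walkInvariant p a i : ℂ) * f i := by
  rw [invariantFunctional_apply, ← ((functional_hasSum _ hs f).mul_left _).tsum_eq]
  congr 1
  funext n
  simp [walkInvariant, mul_assoc]

theorem invariantFunctional_op (hγsum : Summable fun n => a (n + 1) * γ ^ (n + 1))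
    (f : WeightedSpace (geomWeight γ hγ)) :
    invariantFunctional hγ hs ((walk p hp a ha hsum).op (geomWeight γ hγ) h f) =
      invariantFunctional hγ hs f := by
  rw [invariantFunctional_apply, functional_leftEigen_one_op hp ha hsum hγ h hγsum,
    invariantFunctional_apply]

theorem invariantFunctional_one (hp : p ∈ Ioo (0 : ℝ) 1)
    (hsum : HasSum (fun n => a (n + 1)) 1) : invariantFunctional hγ hs (one _) = 1 := by
  have hp0 : (p : ℂ) ≠ 0 := by exact_mod_cast hp.1.ne'
  have hne := one_add_ofReal_ne_zero hp
  rw [invariantFunctional_apply, functional_leftEigen_const hγ hsum one_ne_zero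
    (by linarith [hp.1] : (1 : ℝ) ≠ 1 - p) hs 1 1 (one _) rfl (fun _ => rfl), sub_sub_cancel]
  field_simp
  ring

theorem invariantFunctional_twoValued (hp : p ∈ Ioo (0 : ℝ) 1)
    (hsum : HasSum (fun n => a (n + 1)) 1) :
    invariantFunctional hγ hs (twoValued _ p) = 0 := by
  have hp0 : (p : ℂ) ≠ 0 := by exact_mod_cast hp.1.ne'
  rw [invariantFunctional_apply, functional_leftEigen_const hγ hsum one_ne_zero
    (by linarith [hp.1] : (1 : ℝ) ≠ 1 - p) hs 1 (-p) (twoValued _ p) rfl (fun _ => rfl),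
    sub_sub_cancel]
  field_simp
  ring

theorem exists_walk_convergence_bound (hγsum : Summable fun n => a (n + 1) * γ ^ (n + 1)) {ρ : ℝ}
    (hρ : max ((1 - p) * γ) p < ρ) :
    ∃ C : ℝ, ∀ (n : ℕ) (f : WeightedSpace (geomWeight γ hγ)),
      ‖((walk p hp a ha hsum).op (geomWeight γ hγ) h ^ n) f -
        invariantFunctional hγ hs f • one _‖ ≤ C * ρ ^ n * ‖f‖ := by
  refine exists_norm_pow_sub_le _ _ _ _ _ _ _ _ (walk_op_eq hp ha hsum hγ hγsum h)
    (walk_op_one hp ha hsum hγ h) (walk_op_twoValued hp ha hsum hγ h hγsum)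
    (invariantFunctional_op hp ha hsum hγ h hs hγsum) (invariantFunctional_one hγ hs hp hsum)
    (invariantFunctional_twoValued hγ hs hp hsum) (norm_shift_le hγ _)
    ((le_max_left _ _).trans hρ.le) ?_
  rw [Complex.norm_real, norm_neg, Real.norm_of_nonneg hp.1.le]
  exact (le_max_right _ _).trans_lt hρ

theorem walk_convergesAtRate (hγsum : Summable fun n => a (n + 1) * γ ^ (n + 1))
    (hs : Summable fun n => |leftEigen (1 - p) 1 a n| * (geomWeight γ hγ).val n) {ρ : ℝ}
    (hρ : max ((1 - p) * γ) p < ρ) :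
    (walk p hp a ha hsum).ConvergesAtRate (geomWeight γ hγ) h (walkInvariant p a) ρ := by
  obtain ⟨C, hC⟩ := exists_walk_convergence_bound hp ha hsum hγ h hs hγsum hρ
  have hρ0 : 0 < ρ := hp.1.trans_le ((le_max_right _ _).trans hρ.le)
  refine ⟨|C|, fun n f hf => ?_⟩
  rw [← invariantFunctional_eq_tsum hγ hs]
  calc _ ≤ C * ρ ^ n * ‖f‖ := hC n f
    _ ≤ |C| * ρ ^ n * 1 := by
      gcongr
      exact le_abs_self C
    _ = _ := mul_one _

/-- Above `p` the eigenvalue `-p` is absorbed into `H`, the kernel of the invariant functional. -/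
theorem hasQuasiCompactDecomposition_walk_of_gt
    (hγsum : Summable fun n => a (n + 1) * γ ^ (n + 1)) {r : ℝ}
    (hr : max ((1 - p) * γ) p < r) (hr1 : r < 1)
    (hs : Summable fun n => |leftEigen (1 - p) 1 a n| * (geomWeight γ hγ).val n) :
    HasQuasiCompactDecomposition ((walk p hp a ha hsum).op (geomWeight γ hγ) h) r := by
  obtain ⟨ρ, hρ, hρr⟩ := exists_between hr
  obtain ⟨C, hC⟩ := exists_walk_convergence_bound hp ha hsum hγ h hs hγsum hρ
  refine hasQuasiCompactDecomposition_of_biorthogonal (m := 1) (C := C) le_rfl _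
    (hp.1.le.trans ((le_max_right _ _).trans hρ.le)) hρr (fun _ => 1) (fun _ => one _)
    (fun _ => invariantFunctional hγ hs) (Function.injective_of_subsingleton _)
    (fun _ => by simpa using hr1.le) (fun _ => ?_) (fun _ f => ?_) (fun i j => ?_) fun f hf n => ?_
  · rw [walk_op_one, one_smul]
  · rw [invariantFunctional_op hp ha hsum hγ h hs hγsum, one_mul]
  · rw [invariantFunctional_one hγ hs hp hsum, if_pos (Subsingleton.elim i j)]
  · have h1 := hC n f
    rwa [hf 0, zero_smul, sub_zero] at h1

/-- At a level `r ≤ p` the eigenvalue `-p` must be split off. Here `qγ < r ≤ p`, which is what makes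
its left eigenfunctional bounded. -/
theorem hasQuasiCompactDecomposition_walk_of_le
    (hγsum : Summable fun n => a (n + 1) * γ ^ (n + 1)) {r : ℝ}
    (hr : (1 - p) * γ < r) (hrp : r ≤ p)
    (hs : Summable fun n => |leftEigen (1 - p) 1 a n| * (geomWeight γ hγ).val n) :
    HasQuasiCompactDecomposition ((walk p hp a ha hsum).op (geomWeight γ hγ) h) r := by
  have hne := one_add_ofReal_ne_zero hp
  have hq : 0 ≤ 1 - p := sub_nonneg.2 hp.2.le
  have hs2 : Summable fun n => |leftEigen (1 - p) (-p) a n| * (geomWeight γ hγ).val n :=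
    summable_abs_leftEigen hq hγ (fun n hn => (ha n hn).1) hγsum
      (by rw [abs_neg, abs_of_pos hp.1]; exact hr.trans_le hrp)
  have hlq : -p ≠ 1 - p := by linarith
  have hp0 : -p ≠ 0 := neg_ne_zero.2 hp.1.ne'
  let χ : WeightedSpace (geomWeight γ hγ) →L[ℂ] ℂ := (1 / (1 + p) : ℂ) • functional _ hs2
  have hχa : ∀ f, χ f = (1 / (1 + p) : ℂ) * functional _ hs2 f := fun _ => rfl
  have e : ((-p - (1 - p) : ℝ) : ℂ) = -1 := by
    push_cast
    ring
  have hχ : ∀ f, χ ((walk p hp a ha hsum).op (geomWeight γ hγ) h f) = ((-p : ℝ) : ℂ) * χ f := by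
    intro f
    rw [hχa, hχa, functional_leftEigen_neg_op hp ha hsum hγ h hγsum hs2]
    ring
  have hχ1 : χ (one _) = 0 := by
    rw [hχa, functional_leftEigen_const hγ hsum hp0 hlq hs2 1 1 (one _) rfl (fun _ => rfl), e]
    norm_num
  have hχ2 : χ (twoValued _ p) = 1 := by
    rw [hχa, functional_leftEigen_const hγ hsum hp0 hlq hs2 1 (-p) (twoValued _ p) rfl
      (fun _ => rfl), e]
    field_simp
  obtain ⟨C, hC⟩ := exists_norm_pow_le _ _ _ _ _ χ _ _ _ (walk_op_eq hp ha hsum hγ hγsum h)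
    (walk_op_one hp ha hsum hγ h) (walk_op_twoValued hp ha hsum hγ h hγsum)
    (invariantFunctional_op hp ha hsum hγ h hs hγsum) (invariantFunctional_one hγ hs hp hsum)
    (invariantFunctional_twoValued hγ hs hp hsum) hχ hχ1 hχ2 (norm_shift_le hγ hq)
  have hneq : (1 : ℂ) ≠ ((-p : ℝ) : ℂ) := by
    have : (1 : ℝ) ≠ -p := by linarith [hp.1]
    exact_mod_cast this
  refine hasQuasiCompactDecomposition_of_biorthogonal (m := 2) (C := C) one_le_two _
    (mul_nonneg hq (one_pos.trans hγ).le) hr ![1, ((-p : ℝ) : ℂ)] ![one _, twoValued _ p]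
    ![invariantFunctional hγ hs, χ] ?_ ?_ ?_ ?_ ?_ fun f hf n => hC f (hf 0) (hf 1) n
  · intro i j hij
    fin_cases i <;> fin_cases j
    · rfl
    · exact absurd hij hneq
    · exact absurd hij.symm hneq
    · rfl
  · rw [Fin.forall_fin_two]
    refine ⟨?_, ?_⟩
    · simpa using hrp.trans hp.2.le
    · change r ≤ ‖((-p : ℝ) : ℂ)‖
      rwa [Complex.norm_real, norm_neg, Real.norm_of_nonneg hp.1.le]
  · rw [Fin.forall_fin_two]
    exact ⟨(walk_op_one hp ha hsum hγ h).trans (one_smul ℂ _).symm,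
      walk_op_twoValued hp ha hsum hγ h hγsum⟩
  · rw [Fin.forall_fin_two]
    exact ⟨fun f => (invariantFunctional_op hp ha hsum hγ h hs hγsum f).trans (one_mul _).symm, hχ⟩
  · simp only [Fin.forall_fin_two]
    exact ⟨⟨invariantFunctional_one hγ hs hp hsum, invariantFunctional_twoValued hγ hs hp hsum⟩,
      hχ1, hχ2⟩

end Walk

theorem proposition7 (p q : ℝ) (hp : p ∈ Set.Ioo (0 : ℝ) 1) (hq : q = 1 - p)
    (a : ℕ → ℝ) (ha : ∀ n, 1 ≤ n → a n ∈ Set.Icc (0 : ℝ) 1)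
    (hsum : HasSum (fun n => a (n + 1)) 1)
    (γ : ℝ) (hγ : 1 < γ) (hγq : γ < 1 / q)
    (hγsum : Summable fun n => a (n + 1) * γ ^ (n + 1)) :
    ∃ h : (walk p hp a ha hsum).ActsOn (geomWeight γ hγ),
      (IsQuasiCompact ((walk p hp a ha hsum).op (geomWeight γ hγ) h) ∧
        essSpectralRadius ((walk p hp a ha hsum).op (geomWeight γ hγ) h) ≤ q * γ) ∧
      ∃ π : ℕ → ℝ,
        (walk p hp a ha hsum).IsGeomErgodic (geomWeight γ hγ) h π ∧
        (walk p hp a ha hsum).convRate (geomWeight γ hγ) h π ≤ max (q * γ) p := by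
  subst hq
  have hq0 : 0 < 1 - p := sub_pos.2 hp.2
  have hqγ0 : 0 < (1 - p) * γ := mul_pos hq0 (one_pos.trans hγ)
  have hqγ : (1 - p) * γ < 1 := by
    rw [lt_div_iff₀ hq0] at hγq
    linarith
  have hmax : max ((1 - p) * γ) p < 1 := max_lt hqγ hp.2
  have hs : Summable fun n => |leftEigen (1 - p) 1 a n| * (geomWeight γ hγ).val n :=
    summable_abs_leftEigen hq0.le hγ (fun n hn => (ha n hn).1) hγsum (by simpa using hqγ)
  have h := walk_actsOn hp ha hsum hγ hγsum
  have hdec : ∀ r, (1 - p) * γ < r → r < 1 →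
      HasQuasiCompactDecomposition ((walk p hp a ha hsum).op (geomWeight γ hγ) h) r := by
    intro r hr hr1
    rcases le_or_gt r p with hrp | hrp
    · exact hasQuasiCompactDecomposition_walk_of_le hp ha hsum hγ h hγsum hr hrp hs
    · exact hasQuasiCompactDecomposition_walk_of_gt hp ha hsum hγ h hγsum (max_lt hr hrp) hr1 hs
  refine ⟨h, ⟨?_, ?_⟩, walkInvariant p a,
    ⟨walkInvariant_isInvariantProb hp ha hsum hγ hs, ?_⟩, ?_⟩
  · obtain ⟨r, hr, hr1⟩ := exists_between hqγ
    exact ⟨r, ⟨hqγ0.trans hr, hr1⟩, hdec r hr hr1⟩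
  · unfold essSpectralRadius
    refine le_of_forall_gt_imp_ge_of_dense fun r hr => ?_
    -- The level must also stay below `1`, hence the minimum with `1`; letting `r` decrease to `qγ`
    -- gives the bound.
    obtain ⟨s, hs1, hs2⟩ := exists_between (lt_min hr hqγ)
    have hs3 := hs2.trans_le (min_le_right _ _)
    refine le_trans (csInf_le (a := s) ⟨0, fun _ hx => hx.1.1.le⟩ ?_)
      (hs2.le.trans (min_le_left _ _))
    exact ⟨⟨hqγ0.trans hs1, hs3⟩, hdec s hs1 hs3⟩
  · obtain ⟨ρ, hρ, hρ1⟩ := exists_between hmax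
    exact ⟨ρ, ⟨hp.1.trans_le ((le_max_right _ _).trans hρ.le), hρ1⟩,
      walk_convergesAtRate hp ha hsum hγ h hγsum hs hρ⟩
  · unfold MarkovMatrix.convRate
    refine le_of_forall_gt_imp_ge_of_dense fun r hr => ?_
    obtain ⟨s, hs1, hs2⟩ := exists_between (lt_min hr hmax)
    refine le_trans (csInf_le (a := s) ⟨0, fun _ hx => hx.1.1.le⟩ ?_)
      (hs2.le.trans (min_le_left _ _))
    exact ⟨⟨hp.1.trans_le ((le_max_right _ _).trans hs1.le), hs2.trans_le (min_le_right _ _)⟩,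
      walk_convergesAtRate hp ha hsum hγ h hγsum hs hs1⟩
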